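/- Let $S\subset\mathbb{R}^3$ be a set of $n$ points in convex position (no point of $S$ lies in the convex hull of the others) and in general position (any at most four points of $S$ are affinely independent), and let $\kappa\colon S\to K$ be a coloring with a set $K$ of $m$ colors, each of which is used by at least one point. Consider oriented triangles $\sigma$ with vertex set $D_\sigma\subseteq S$, $|D_\sigma|=3$, where the orientation selects one of the two open half-spaces bounded by the plane through $D_\sigma$, denoted $\sigma^+$. Such a $\sigma$ is a *$c$-chromatic colored $j$-facet* if $|\kappa(D_\sigma)|=c$, exactly $j$ colors occur among the points of $S\cap\sigma^+$, and none of these colors belongs to $\kappa(D_\sigma)$. Let $e_{c,j}$ be the number of $c$-chromatic colored $j$-facets. Then for every integer $0\le j\le m-2$, $$e_{3,j}+\sum_{i=0}^{j}e_{2,i}+\sum_{i=0}^{j}(j-i+1)\,e_{1,i}=2(j+1)(n-j-2).$$ In particular, if $m=n$, then for every $0\le j\le n-2$ the number $e_j=e_{1,j}+e_{2,j}+e_{3,j}$ equals $2(j+1)(n-j-2)$, and so does the number of uncolored $j$-facets of $S$, that is, of oriented triangles $\sigma$ with vertices in $S$ such that $\sigma^+$ contains exactly $j$ points of $S$. -/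

import Mathlib

namespace ColoredFacets

/-- A finite point set in `ℝ^d` is in general position if any at most `d + 1` of its points are
affinely independent (for `d = 3`: no three collinear, no four coplanar). -/
def InGeneralPosition {d : ℕ} (S : Finset (EuclideanSpace ℝ (Fin d))) : Prop :=
  ∀ T : Finset (EuclideanSpace ℝ (Fin d)), T ⊆ S → T.card ≤ d + 1 →
    AffineIndependent ℝ ((↑) : T → EuclideanSpace ℝ (Fin d))

/-- A finite point set is in convex position if none of its points lies in the convex hull of
the others. -/
def InConvexPosition {d : ℕ} (S : Finset (EuclideanSpace ℝ (Fin d))) : Prop :=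
  ConvexIndependent ℝ ((↑) : S → EuclideanSpace ℝ (Fin d))

/-- An oriented `(d-1)`-simplex in `ℝ^d`: `d` affinely independent vertices, together with
the orientation, given as the choice of one of the two open half-spaces
bounded by the hyperplane through the vertices (the positive side of the simplex). -/
@[ext]
structure OrientedSimplex (d : ℕ) where
  /-- the vertices -/
  verts : Finset (EuclideanSpace ℝ (Fin d))
  card_verts : verts.card = d
  affineIndependent : AffineIndependent ℝ ((↑) : verts → EuclideanSpace ℝ (Fin d))
  /-- the open half-space on the positive side -/
  posSide : Set (EuclideanSpace ℝ (Fin d))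
  isHalfSpace : ∃ (f : EuclideanSpace ℝ (Fin d) →ₗ[ℝ] ℝ) (a : ℝ), f ≠ 0 ∧
    (∀ p ∈ verts, f p = a) ∧ posSide = {x | a < f x}

/-- The (uncolored) `j`-facets in `S`. -/
def facets {d : ℕ} (S : Finset (EuclideanSpace ℝ (Fin d))) (j : ℕ) : Set (OrientedSimplex d) :=
  {σ | σ.verts ⊆ S ∧ {s | s ∈ S ∧ s ∈ σ.posSide}.ncard = j}

variable {d : ℕ} {K : Type*} {S : Finset (EuclideanSpace ℝ (Fin d))}

/-- The set of colors intersected by `A`, i.e. the colors of the points of `S` in `A`. -/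
def colorsOf (κ : S → K) (A : Set (EuclideanSpace ℝ (Fin d))) : Set K :=
  {i | ∃ s : S, (s : EuclideanSpace ℝ (Fin d)) ∈ A ∧ κ s = i}

/-- The `c`-chromatic colored `j`-facets in `S` with respect to the coloring `κ`: simplices with
vertices in `S`, the vertices having exactly `c` colors, whose positive side intersects
exactly `j` colors, none of which is a color of a vertex. -/
def chromaticFacets (κ : S → K) (c j : ℕ) : Set (OrientedSimplex d) :=
  {σ | σ.verts ⊆ S ∧
    Disjoint (colorsOf κ σ.posSide) (colorsOf κ (σ.verts : Set (EuclideanSpace ℝ (Fin d)))) ∧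
    (colorsOf κ σ.posSide).ncard = j ∧
    (colorsOf κ (σ.verts : Set (EuclideanSpace ℝ (Fin d)))).ncard = c}

/-- `e_{c,j}`: the number of `c`-chromatic colored `j`-facets. -/
noncomputable def e (κ : S → K) (c j : ℕ) : ℕ := (chromaticFacets κ c j).ncard

end ColoredFacets

/-! The proof is by random sampling. Keep each color independently with probability `1 - X`, where
`X` is a formal variable, and let `T` be the set of points whose color survives. A triangle with `c`
vertex colors and `b` colors on its positive side is a `0`-facet of `T` exactly when all its vertex
colors survive and no color of its positive side does. This has probability `(1 - X) ^ c * X ^ b` if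
the two color sets are disjoint, and `0` otherwise.

On the other hand, `T` is again in convex and general position, so it has `2 (|T| - 2)` facets once
`|T| ≥ 2` (`ncard_facets_zero`). Its expected size is `n (1 - X)`. The two counts give `∑ (1 - X) ^
c * X ^ b = 2 n (1 - X) - 4` modulo `X ^ (m - 1)`, the error coming from samples with fewer than two
colors (`X_pow_dvd_sum_simplices`). Multiplying by `(1 - X)⁻³` and reading off the coefficient of `X
^ j`, where `j ≤ m - 2`, gives the relation (`coeff_contribution`, `colored_facet_relation`).

The facet count avoids Euler's formula. Fix a linear functional `f` injective on `T`; every facet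
has a unique middle vertex with respect to `f`. Conversely, every point `v` other than the minimum
and the maximum of `f` is the middle vertex of exactly two facets (`ncard_middle_facets`): the line
`f = f v` crosses the boundary of the vertex figure at `v`, a convex polygon, in two edges. Each
crossing is found by maximizing a slope (`existsUnique_crossing_edge`). -/

namespace ColoredFacets

/-! ### Determinants and the edges of a cone crossed by a plane -/

section Determinant

variable {V : Type*} [AddCommGroup V] [Module ℝ V]

/-- The determinant of the values of three functionals at three vectors. -/
def detOf (f g h : Module.Dual ℝ V) (x y z : V) : ℝ :=
  f x * (g y * h z - h y * g z) - g x * (f y * h z - h y * f z) + h x * (f y * g z - g y * f z)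

variable {f g h : Module.Dual ℝ V}

/-- `detOf` as a functional of its last argument. -/
def detFunctional (f g h : Module.Dual ℝ V) (x y : V) : Module.Dual ℝ V :=
  (f x * g y - g x * f y) • h - (f x * h y - h x * f y) • g + (g x * h y - h x * g y) • f

theorem detFunctional_apply (x y z : V) : detFunctional f g h x y z = detOf f g h x y z := by
  simp only [detFunctional, detOf, LinearMap.add_apply, LinearMap.sub_apply, LinearMap.smul_apply,
    smul_eq_mul]
  ring

theorem detOf_neg (x y z : V) : detOf f g (-h) x y z = -detOf f g h x y z := by
  simp only [detOf, LinearMap.neg_apply]; ring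

theorem detOf_left (x y : V) : detOf f g h x y x = 0 := by
  simp only [detOf]; ring

theorem detOf_right (x y : V) : detOf f g h x y y = 0 := by
  simp only [detOf]; ring

/-- Cramer's rule. -/
theorem detOf_smul (hker : ∀ x, f x = 0 → g x = 0 → h x = 0 → x = 0) (a b c x : V) :
    detOf f g h a b c • x
      = detOf f g h x b c • a + detOf f g h a x c • b + detOf f g h a b x • c := by
  rw [← sub_eq_zero]
  -- The common kernel is trivial, so it suffices to compare the values of `f`, `g` and `h`, which
  -- is a polynomial identity.
  apply hker <;> simp only [detOf, map_sub, map_add, map_smul, smul_eq_mul] <;> ring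

/-- Three vectors with vanishing determinant are linearly dependent. -/
theorem exists_of_detOf_eq_zero (hker : ∀ x, f x = 0 → g x = 0 → h x = 0 → x = 0) {a b c : V}
    (hd : detOf f g h a b c = 0) :
    ∃ r s t : ℝ, (r ≠ 0 ∨ s ≠ 0 ∨ t ≠ 0) ∧ r • a + s • b + t • c = 0 := by
  have hdet : (!![f a, f b, f c; g a, g b, g c; h a, h b, h c] : Matrix _ _ ℝ).det = 0 := by
    rw [Matrix.det_fin_three]
    simp only [detOf] at hd
    simp
    linarith
  obtain ⟨w, hw, hw0⟩ := Matrix.exists_mulVec_eq_zero_iff.mpr hdet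
  refine ⟨w 0, w 1, w 2, ?_, ?_⟩
  · by_contra! hcon
    apply hw
    ext i
    fin_cases i <;> simp [hcon]
  · have h0 := congrFun hw0 0
    have h1 := congrFun hw0 1
    have h2 := congrFun hw0 2
    simp [Matrix.mulVec, dotProduct, Fin.sum_univ_three] at h0 h1 h2
    apply hker <;> simp only [map_add, map_smul, smul_eq_mul] <;> linarith

/-- A functional vanishing at two independent vectors is a multiple of the determinant. -/
theorem exists_eq_smul_detOf (hker : ∀ x, f x = 0 → g x = 0 → h x = 0 → x = 0) {a b : V}
    (hab : ∀ r s : ℝ, r • a + s • b = 0 → r = 0 ∧ s = 0) {F : Module.Dual ℝ V} (hF : F ≠ 0)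
    (ha : F a = 0) (hb : F b = 0) :
    ∃ c : ℝ, c ≠ 0 ∧ ∀ x, F x = c * detOf f g h a b x := by
  obtain ⟨u, hu⟩ : ∃ u, F u ≠ 0 := by
    by_contra! hcon
    exact hF (LinearMap.ext hcon)
  have hd : detOf f g h a b u ≠ 0 := by
    intro hd
    obtain ⟨r, s, t, hne, hsum⟩ := exists_of_detOf_eq_zero hker hd
    have := congrArg F hsum
    simp only [map_add, map_smul, ha, hb, smul_eq_mul, mul_zero, zero_add, map_zero,
      mul_eq_zero, hu, or_false] at this
    subst this
    rw [zero_smul, add_zero] at hsum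
    obtain ⟨rfl, rfl⟩ := hab r s hsum
    simp at hne
  refine ⟨F u / detOf f g h a b u, div_ne_zero hu hd, fun x ↦ ?_⟩
  have := congrArg F (detOf_smul hker a b u x)
  simp only [map_add, map_smul, ha, hb, smul_eq_mul, mul_zero, zero_add] at this
  field_simp
  linarith

/-- The segments `ab` and `cd` meet the kernel of `f` in multiples of the two combinations on the
right. The right side compares their slopes `h / g`, so it changes sign when the two pairs are
swapped. -/
theorem detOf_crossing (a b c d : V) :
    f d * detOf f g h a b c - f c * detOf f g h a b d
      = h (f b • a - f a • b) * g (f d • c - f c • d)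
        - g (f b • a - f a • b) * h (f d • c - f c • d) := by
  simp only [detOf, map_sub, map_smul, smul_eq_mul]
  ring

/-- Given finitely many vectors in general position, on the positive side of `g` and on both
sides of `f`, exactly one edge of the cone spanned by them crosses the kernel of `f` in the
direction of increasing `h`. -/
theorem existsUnique_crossing_edge (U : Finset V) (hg : ∀ x ∈ U, 0 < g x)
    (hf : ∀ x ∈ U, f x ≠ 0)
    (hgen : ∀ x ∈ U, ∀ y ∈ U, ∀ z ∈ U, x ≠ y → x ≠ z → y ≠ z → detOf f g h x y z ≠ 0)
    (hneg : ∃ a ∈ U, f a < 0) (hpos : ∃ b ∈ U, 0 < f b) :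
    ∃! p : V × V, (p.1 ∈ U ∧ f p.1 < 0) ∧ (p.2 ∈ U ∧ 0 < f p.2) ∧
      ∀ x ∈ U, 0 ≤ detOf f g h p.1 p.2 x := by
  classical
  have hw : ∀ a ∈ U, ∀ b ∈ U, f a < 0 → 0 < f b → 0 < g (f b • a - f a • b) := by
    intro a ha b hb hfa hfb
    have h1 := mul_pos hfb (hg a ha)
    have h2 := mul_neg_of_neg_of_pos hfa (hg b hb)
    simp only [map_sub, map_smul, smul_eq_mul]
    linarith
  obtain ⟨a₀, ha₀, hfa₀⟩ := hneg
  obtain ⟨b₀, hb₀, hfb₀⟩ := hpos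
  -- The crossing edge is the pair whose intersection with the kernel of `f` has the largest slope
  -- `h / g`; `hw` makes the denominators positive.
  obtain ⟨⟨a, b⟩, hab, hmax⟩ := Finset.exists_max_image
    ((U.filter fun x ↦ f x < 0) ×ˢ (U.filter fun x ↦ 0 < f x))
    (fun p ↦ h (f p.2 • p.1 - f p.1 • p.2) / g (f p.2 • p.1 - f p.1 • p.2))
    ⟨(a₀, b₀), by simp [ha₀, hfa₀, hb₀, hfb₀]⟩
  simp only [Finset.mem_product, Finset.mem_filter, Prod.forall] at hab hmax
  obtain ⟨⟨ha, hfa⟩, hb, hfb⟩ := hab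
  have hcross : ∀ c ∈ U, ∀ d ∈ U, f c < 0 → 0 < f d →
      0 ≤ f d * detOf f g h a b c - f c * detOf f g h a b d := by
    intro c hc d hd hfc hfd
    rw [detOf_crossing]
    have := hmax c d ⟨⟨hc, hfc⟩, hd, hfd⟩
    rw [div_le_div_iff₀ (hw c hc d hd hfc hfd) (hw a ha b hb hfa hfb)] at this
    linarith
  -- Replacing only the endpoint of `ab` on the same side as `x` makes one of the two determinants
  -- in `hcross` vanish.
  have hedge : ∀ x ∈ U, 0 ≤ detOf f g h a b x := by
    intro x hx
    rcases lt_or_gt_of_ne (hf x hx) with hfx | hfx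
    · have := hcross x hx b hb hfx hfb
      rw [detOf_right, mul_zero, sub_zero] at this
      exact nonneg_of_mul_nonneg_right this hfb
    · have := hcross a ha x hx hfa hfx
      rw [detOf_left, mul_zero, zero_sub, ← neg_mul] at this
      exact nonneg_of_mul_nonneg_right this (by linarith)
  refine ⟨(a, b), ⟨⟨ha, hfa⟩, ⟨hb, hfb⟩, hedge⟩, ?_⟩
  rintro ⟨c, d⟩ ⟨⟨hc, hfc⟩, ⟨hd, hfd⟩, hedge'⟩
  dsimp only at hc hfc hd hfd hedge'
  -- By antisymmetry the left sides of `h1` and `h2` sum to zero. They consist of four nonnegative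
  -- terms, so each one vanishes, and general position forces the two pairs to agree.
  have h1 := detOf_crossing (f := f) (g := g) (h := h) a b c d
  have h2 := detOf_crossing (f := f) (g := g) (h := h) c d a b
  have p1 := mul_nonneg hfd.le (hedge c hc)
  have p2 := mul_nonneg (neg_nonneg.mpr hfc.le) (hedge d hd)
  have p3 := mul_nonneg hfb.le (hedge' a ha)
  have p4 := mul_nonneg (neg_nonneg.mpr hfa.le) (hedge' b hb)
  have hdc : detOf f g h a b c = 0 :=
    (mul_eq_zero.mp (by linarith : f d * detOf f g h a b c = 0)).resolve_left hfd.ne'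
  have hdd : detOf f g h a b d = 0 :=
    (mul_eq_zero.mp (by linarith : -f c * detOf f g h a b d = 0)).resolve_left (by linarith)
  have hne : ∀ x y, f x < 0 → 0 < f y → x ≠ y := by
    rintro x y hx hy rfl
    linarith
  have hca : c = a := by
    by_contra hca
    exact hgen a ha b hb c hc (hne _ _ hfa hfb) (Ne.symm hca) (hne _ _ hfc hfb).symm hdc
  have hdb : d = b := by
    by_contra hdb
    exact hgen a ha b hb d hd (hne _ _ hfa hfb) (hne _ _ hfa hfd) (Ne.symm hdb) hdd
  rw [hca, hdb]

end Determinant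

/-! ### Facets with a prescribed middle vertex -/

section Middle

/-- The nonzero minor makes `(f, g)` surjective onto the plane, so the common kernel is a line, and
any `h` nonzero on this line works. -/
theorem exists_complementary_functional {V : Type*} [AddCommGroup V] [Module ℝ V]
    (hV : Module.finrank ℝ V = 3) (f g : Module.Dual ℝ V) {a b : V}
    (hab : f a * g b - g a * f b ≠ 0) :
    ∃ h : Module.Dual ℝ V, (∀ x, f x = 0 → g x = 0 → h x = 0 → x = 0) ∧
      ∃ k, f k = 0 ∧ g k = 0 ∧ h k ≠ 0 := by
  have : FiniteDimensional ℝ V := Module.finite_of_finrank_pos (by omega)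
  have hsurj : LinearMap.range (f.prod g) = ⊤ := by
    rw [LinearMap.range_eq_top]
    rintro ⟨s, t⟩
    refine ⟨((s * g b - t * f b) / (f a * g b - g a * f b)) • a
      + ((t * f a - s * g a) / (f a * g b - g a * f b)) • b, ?_⟩
    ext
    · simp only [LinearMap.prod_apply, Function.prod, map_add, map_smul,
        Prod.fst_add, Prod.smul_fst, smul_eq_mul]
      rw [div_mul_eq_mul_div, div_mul_eq_mul_div, ← add_div, div_eq_iff hab]
      ring
    · simp only [LinearMap.prod_apply, Function.prod, map_add, map_smul,
        Prod.snd_add, Prod.smul_snd, smul_eq_mul]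
      rw [div_mul_eq_mul_div, div_mul_eq_mul_div, ← add_div, div_eq_iff hab]
      ring
  have hrank := LinearMap.finrank_range_add_finrank_ker (f.prod g)
  rw [hsurj, finrank_top, hV, Module.finrank_prod, Module.finrank_self] at hrank
  have hone : Module.finrank ℝ (LinearMap.ker (f.prod g)) = 1 := by omega
  obtain ⟨⟨k, hk⟩, hk0, hspan⟩ := finrank_eq_one_iff'.mp hone
  have hk0' : k ≠ 0 := fun hc ↦ hk0 (Subtype.ext hc)
  simp only [LinearMap.mem_ker, LinearMap.prod_apply, Function.prod, Prod.mk_eq_zero] at hk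
  obtain ⟨h, hh⟩ : ∃ h : Module.Dual ℝ V, h k ≠ 0 := by
    by_contra! hcon
    exact hk0' ((Module.forall_dual_apply_eq_zero_iff ℝ k).mp hcon)
  refine ⟨h, fun x hfx hgx hhx ↦ ?_, k, hk.1, hk.2, hh⟩
  obtain ⟨c, hc⟩ := hspan ⟨x, by simp [hfx, hgx]⟩
  have hc' : c • k = x := congrArg Subtype.val hc
  rw [← hc', map_smul, smul_eq_mul, mul_eq_zero, or_iff_left hh] at hhx
  rw [← hc', hhx, zero_smul]

/-- There is a functional separating finitely many points pairwise. -/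
theorem exists_dual_injOn {V : Type*} [AddCommGroup V] [Module ℝ V] (T : Finset V) :
    ∃ f : Module.Dual ℝ V, Set.InjOn f T := by
  obtain ⟨f, hf⟩ := Module.exists_dual_forall_apply_ne_zero (K := ℝ)
    (fun p : {p : T × T // p.1 ≠ p.2} ↦ (p.1.1 : V) - p.1.2)
    (fun p hp ↦ p.2 (Subtype.ext (sub_eq_zero.mp hp)))
  refine ⟨f, fun x hx y hy hxy ↦ ?_⟩
  by_contra hne
  refine hf ⟨(⟨x, hx⟩, ⟨y, hy⟩), fun hc ↦ hne (congrArg Subtype.val hc)⟩ ?_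
  simp [hxy]

variable {d : ℕ}

theorem InGeneralPosition.mono {S T : Finset (EuclideanSpace ℝ (Fin d))}
    (hS : InGeneralPosition S) (h : T ⊆ S) : InGeneralPosition T :=
  fun D hD hc ↦ hS D (hD.trans h) hc

theorem InConvexPosition.mono {S T : Finset (EuclideanSpace ℝ (Fin d))}
    (hS : InConvexPosition S) (h : T ⊆ S) : InConvexPosition T :=
  ConvexIndependent.mono (t := (S : Set (EuclideanSpace ℝ (Fin d)))) hS
    (s := (T : Set (EuclideanSpace ℝ (Fin d)))) h

/-- A point of a set in convex position can be strictly separated from the others. -/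
theorem InConvexPosition.exists_dual {T : Finset (EuclideanSpace ℝ (Fin d))}
    (hT : InConvexPosition T) {v : EuclideanSpace ℝ (Fin d)} (hv : v ∈ T) :
    ∃ g : Module.Dual ℝ (EuclideanSpace ℝ (Fin d)), ∀ x ∈ T, x ≠ v → g v < g x := by
  have hnot := (convexIndependent_set_iff_notMem_convexHull_sdiff
    (s := (T : Set (EuclideanSpace ℝ (Fin d))))).mp hT v hv
  have hfin : ((T : Set (EuclideanSpace ℝ (Fin d))) \ {v}).Finite := T.finite_toSet.sdiff
  obtain ⟨g, u, hgv, hgu⟩ := geometric_hahn_banach_point_closed (convex_convexHull ℝ _)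
    (hfin.isClosed_convexHull ℝ) hnot
  exact ⟨g.toLinearMap, fun x hx hxv ↦ hgv.trans (hgu x (subset_convexHull ℝ _ ⟨hx, hxv⟩))⟩

theorem InGeneralPosition.affineIndependent {ι : Type*} [Fintype ι]
    {S : Finset (EuclideanSpace ℝ (Fin d))} (hS : InGeneralPosition S)
    {p : ι → EuclideanSpace ℝ (Fin d)} (hp : ∀ i, p i ∈ S) (hinj : Function.Injective p)
    (hcard : Fintype.card ι ≤ d + 1) : AffineIndependent ℝ p := by
  classical
  have hD := hS (Finset.univ.image p) (by simpa [Finset.image_subset_iff] using hp)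
    (Finset.card_image_le.trans hcard)
  refine AffineIndependent.of_set_of_injective ?_ hinj
  have hr : Set.range p = ((Finset.univ.image p : Finset _) : Set (EuclideanSpace ℝ (Fin d))) := by
    simp
  rw [hr]
  exact hD

theorem InGeneralPosition.coeffs_eq_zero {S : Finset (EuclideanSpace ℝ (Fin 3))}
    (hS : InGeneralPosition S) {v x y z : EuclideanSpace ℝ (Fin 3)} (hv : v ∈ S) (hx : x ∈ S)
    (hy : y ∈ S) (hz : z ∈ S) (hvx : v ≠ x) (hvy : v ≠ y) (hvz : v ≠ z) (hxy : x ≠ y)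
    (hxz : x ≠ z) (hyz : y ≠ z) {r s t : ℝ}
    (h : r • (x - v) + s • (y - v) + t • (z - v) = 0) : r = 0 ∧ s = 0 ∧ t = 0 := by
  have haff : AffineIndependent ℝ ![v, x, y, z] := by
    refine hS.affineIndependent ?_ ?_ (by simp)
    · intro i
      fin_cases i <;> simp [*]
    · intro i k
      fin_cases i <;> fin_cases k <;> simp [*, Ne.symm]
  -- The weight of `v` is chosen so that all weights sum to zero.
  have hw := (affineIndependent_iff.mp haff) Finset.univ ![-(r + s + t), r, s, t]
    (by simp [Fin.sum_univ_four]; ring)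
    (by
      rw [← h]
      simp [Fin.sum_univ_four]
      module)
  exact ⟨by simpa using hw 1 (by simp), by simpa using hw 2 (by simp), by simpa using hw 3 (by simp)⟩

theorem InGeneralPosition.coeffs_eq_zero_of_three {S : Finset (EuclideanSpace ℝ (Fin 3))}
    (hS : InGeneralPosition S) {v x y : EuclideanSpace ℝ (Fin 3)} (hv : v ∈ S) (hx : x ∈ S)
    (hy : y ∈ S) (hvx : v ≠ x) (hvy : v ≠ y) (hxy : x ≠ y) {r s : ℝ}
    (h : r • (x - v) + s • (y - v) = 0) : r = 0 ∧ s = 0 := by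
  have haff : AffineIndependent ℝ ![v, x, y] := by
    refine hS.affineIndependent ?_ ?_ (by simp)
    · intro i
      fin_cases i <;> simp [*]
    · intro i k
      fin_cases i <;> fin_cases k <;> simp [*, Ne.symm]
  have hw := (affineIndependent_iff.mp haff) Finset.univ ![-(r + s), r, s]
    (by simp [Fin.sum_univ_three])
    (by
      rw [← h]
      simp [Fin.sum_univ_three]
      module)
  exact ⟨by simpa using hw 1 (by simp), by simpa using hw 2 (by simp)⟩

theorem OrientedSimplex.posSide_nonempty (σ : OrientedSimplex d) : σ.posSide.Nonempty := by
  obtain ⟨F, a, hF, -, hside⟩ := σ.isHalfSpace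
  obtain ⟨u, hu⟩ : ∃ u, F u ≠ 0 := by
    by_contra! hcon
    exact hF (LinearMap.ext hcon)
  refine ⟨((a + 1) / F u) • u, ?_⟩
  rw [hside, Set.mem_ofPred_eq, map_smul, smul_eq_mul, div_mul_cancel₀ _ hu]
  linarith

theorem OrientedSimplex.notMem_posSide (σ : OrientedSimplex d) {p : EuclideanSpace ℝ (Fin d)}
    (hp : p ∈ σ.verts) : p ∉ σ.posSide := by
  obtain ⟨F, a, -, hv, hside⟩ := σ.isHalfSpace
  rw [hside, Set.mem_ofPred_eq, hv p hp]
  exact lt_irrefl a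

theorem mem_facets_zero {T : Finset (EuclideanSpace ℝ (Fin d))} {σ : OrientedSimplex d} :
    σ ∈ facets T 0 ↔ σ.verts ⊆ T ∧ ∀ x ∈ T, x ∉ σ.posSide := by
  have hfin : {s | s ∈ T ∧ s ∈ σ.posSide}.Finite := T.finite_toSet.subset fun s hs ↦ hs.1
  rw [facets, Set.mem_ofPred_eq, Set.ncard_eq_zero hfin, Set.eq_empty_iff_forall_notMem]
  simp

/-- The vertex `v` of `σ` lies between two other vertices with respect to `f`. -/
def IsMiddle (f : Module.Dual ℝ (EuclideanSpace ℝ (Fin d))) (σ : OrientedSimplex d)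
    (v : EuclideanSpace ℝ (Fin d)) : Prop :=
  v ∈ σ.verts ∧ (∃ a ∈ σ.verts, f a < f v) ∧ ∃ b ∈ σ.verts, f v < f b

theorem IsMiddle.exists_verts_eq {f : Module.Dual ℝ (EuclideanSpace ℝ (Fin 3))}
    {σ : OrientedSimplex 3} {v : EuclideanSpace ℝ (Fin 3)} (h : IsMiddle f σ v) :
    ∃ a b, f a < f v ∧ f v < f b ∧ σ.verts = {v, a, b} := by
  obtain ⟨hv, ⟨a, ha, hfa⟩, b, hb, hfb⟩ := h
  refine ⟨a, b, hfa, hfb, (Finset.eq_of_subset_of_card_le ?_ ?_).symm⟩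
  · simp [Finset.insert_subset_iff, hv, ha, hb]
  · rw [σ.card_verts, Finset.card_eq_three.mpr ⟨v, a, b, ?_, ?_, ?_, rfl⟩]
    · rintro rfl; exact lt_irrefl _ hfa
    · rintro rfl; exact lt_irrefl _ hfb
    · rintro rfl; exact lt_asymm hfa hfb

theorem eq_of_insert_eq {f : Module.Dual ℝ (EuclideanSpace ℝ (Fin 3))}
    {v a b a' b' : EuclideanSpace ℝ (Fin 3)} (ha : f a < f v) (hb : f v < f b)
    (ha' : f a' < f v) (hb' : f v < f b')
    (h : ({v, a, b} : Finset (EuclideanSpace ℝ (Fin 3))) = {v, a', b'}) : a = a' ∧ b = b' := by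
  have h1 : a ∈ ({v, a', b'} : Finset (EuclideanSpace ℝ (Fin 3))) := by rw [← h]; simp
  have h2 : b ∈ ({v, a', b'} : Finset (EuclideanSpace ℝ (Fin 3))) := by rw [← h]; simp
  simp only [Finset.mem_insert, Finset.mem_singleton] at h1 h2
  constructor
  · rcases h1 with rfl | h1 | rfl
    · exact absurd ha (lt_irrefl _)
    · exact h1
    · exact absurd hb' ha.asymm
  · rcases h2 with rfl | rfl | h2
    · exact absurd hb (lt_irrefl _)
    · exact absurd hb ha'.asymm
    · exact h2

/-- The `0`-facets with middle vertex `v` that are oriented according to `h`: there is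
exactly one. -/
theorem exists_middle_facet {T : Finset (EuclideanSpace ℝ (Fin 3))}
    (hgen : InGeneralPosition T) {f g h : Module.Dual ℝ (EuclideanSpace ℝ (Fin 3))}
    (hf : Set.InjOn f T) {v : EuclideanSpace ℝ (Fin 3)} (hv : v ∈ T)
    (hg : ∀ x ∈ T, x ≠ v → g v < g x) (hlow : ∃ a ∈ T, f a < f v) (hup : ∃ b ∈ T, f v < f b)
    (hker : ∀ x, f x = 0 → g x = 0 → h x = 0 → x = 0)
    (hk : ∃ k, f k = 0 ∧ g k = 0 ∧ h k ≠ 0) :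
    ∃ (σ : OrientedSimplex 3) (a b : EuclideanSpace ℝ (Fin 3)), σ ∈ facets T 0 ∧
      f a < f v ∧ f v < f b ∧ σ.verts = {v, a, b} ∧
      σ.posSide = {x | detOf f g h (a - v) (b - v) (x - v) < 0} ∧
      ∀ (τ : OrientedSimplex 3) (a' b' : EuclideanSpace ℝ (Fin 3)), τ ∈ facets T 0 →
        f a' < f v → f v < f b' → τ.verts = {v, a', b'} →
        τ.posSide = {x | detOf f g h (a' - v) (b' - v) (x - v) < 0} → τ = σ := by
  classical
  obtain ⟨⟨a₁, b₁⟩, ⟨⟨ha₁, hfa₁⟩, ⟨hb₁, hfb₁⟩, hedge⟩, huniq⟩ := existsUnique_crossing_edge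
    (f := f) (g := g) (h := h) ((T.erase v).image (· - v))
    (by
      simp only [Finset.mem_image, Finset.mem_erase, forall_exists_index, and_imp]
      rintro _ x hxv hx rfl
      simpa using hg x hx hxv)
    (by
      simp only [Finset.mem_image, Finset.mem_erase, forall_exists_index, and_imp]
      rintro _ x hxv hx rfl h0
      rw [map_sub, sub_eq_zero] at h0
      exact hxv (hf hx hv h0))
    (by
      simp only [Finset.mem_image, Finset.mem_erase, forall_exists_index, and_imp]
      rintro _ x hxv hx rfl _ y hyv hy rfl _ z hzv hz rfl hxy hxz hyz hd
      obtain ⟨r, s, t, hne, hsum⟩ := exists_of_detOf_eq_zero hker hd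
      obtain ⟨rfl, rfl, rfl⟩ := hgen.coeffs_eq_zero hv hx hy hz hxv.symm hyv.symm hzv.symm
        (fun e ↦ hxy (by rw [e])) (fun e ↦ hxz (by rw [e])) (fun e ↦ hyz (by rw [e])) hsum
      simp at hne)
    (by
      obtain ⟨a, ha, hfa⟩ := hlow
      refine ⟨a - v, Finset.mem_image_of_mem _ (Finset.mem_erase.mpr ⟨?_, ha⟩), by simpa using hfa⟩
      rintro rfl
      exact lt_irrefl _ hfa)
    (by
      obtain ⟨b, hb, hfb⟩ := hup
      refine ⟨b - v, Finset.mem_image_of_mem _ (Finset.mem_erase.mpr ⟨?_, hb⟩), by simpa using hfb⟩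
      rintro rfl
      exact lt_irrefl _ hfb)
  simp only [Finset.mem_image, Finset.mem_erase] at ha₁ hb₁
  obtain ⟨a, ⟨hav, ha⟩, rfl⟩ := ha₁
  obtain ⟨b, ⟨hbv, hb⟩, rfl⟩ := hb₁
  have hfa : f a < f v := by simpa using hfa₁
  have hfb : f v < f b := by simpa using hfb₁
  have hab : a ≠ b := by
    rintro rfl
    exact lt_asymm hfa hfb
  have hcard : ({v, a, b} : Finset (EuclideanSpace ℝ (Fin 3))).card = 3 :=
    Finset.card_eq_three.mpr ⟨v, a, b, hav.symm, hbv.symm, hab, rfl⟩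
  have hsub : ({v, a, b} : Finset (EuclideanSpace ℝ (Fin 3))) ⊆ T := by
    simp [Finset.insert_subset_iff, hv, ha, hb]
  have hne : detFunctional f g h (a - v) (b - v) ≠ 0 := by
    intro h0
    obtain ⟨k, hfk, hgk, hhk⟩ := hk
    have := DFunLike.congr_fun h0 k
    rw [detFunctional_apply] at this
    simp only [detOf, hfk, hgk, LinearMap.zero_apply] at this
    -- At `k` the determinant reduces to a 2×2 minor times `h k`. The minor is negative because `f`
    -- separates `a` and `b` around `v` while `g` is positive on both differences.
    have hprod : (f (a - v) * g (b - v) - g (a - v) * f (b - v)) * h k = 0 := by linarith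
    have h1 := mul_neg_of_neg_of_pos hfa₁ (by simpa using hg b hb hbv : 0 < g (b - v))
    have h2 := mul_pos (by simpa using hg a ha hav : 0 < g (a - v)) hfb₁
    rcases mul_eq_zero.mp hprod with h3 | h3
    · dsimp only at h1 h2
      linarith
    · exact hhk h3
  let σ : OrientedSimplex 3 :=
    { verts := {v, a, b}
      card_verts := hcard
      affineIndependent := hgen _ hsub (by omega)
      posSide := {x | detOf f g h (a - v) (b - v) (x - v) < 0}
      isHalfSpace := by
        refine ⟨-detFunctional f g h (a - v) (b - v), -detFunctional f g h (a - v) (b - v) v,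
          neg_ne_zero.mpr hne, ?_, ?_⟩
        · intro p hp
          simp only [Finset.mem_insert, Finset.mem_singleton] at hp
          rw [LinearMap.neg_apply, neg_inj, ← sub_eq_zero, ← map_sub, detFunctional_apply]
          rcases hp with rfl | rfl | rfl
          · rw [sub_self p]; simp [detOf]
          · exact detOf_left _ _
          · exact detOf_right _ _
        · ext x
          rw [Set.mem_ofPred_eq, Set.mem_ofPred_eq, LinearMap.neg_apply, neg_lt_neg_iff,
            ← sub_neg (b := detFunctional f g h (a - v) (b - v) v), ← map_sub,
            detFunctional_apply] }
  refine ⟨σ, a, b, mem_facets_zero.mpr ⟨hsub, fun x hx hneg ↦ ?_⟩, hfa, hfb, rfl, rfl, ?_⟩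
  · by_cases hxv : x = v
    · subst hxv
      simp [σ, detOf] at hneg
    · exact absurd hneg (not_lt.mpr (hedge (x - v)
        (Finset.mem_image_of_mem _ (Finset.mem_erase.mpr ⟨hxv, hx⟩))))
  · intro τ a' b' hτ hfa' hfb' hverts hside
    obtain ⟨hτT, hempty⟩ := mem_facets_zero.mp hτ
    have ha' : a' ∈ T := hτT (by simp [hverts])
    have hb' : b' ∈ T := hτT (by simp [hverts])
    have hav' : a' ≠ v := fun e ↦ lt_irrefl (f v) (e ▸ hfa')
    have hbv' : b' ≠ v := fun e ↦ lt_irrefl (f v) (e ▸ hfb')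
    have heq := huniq (a' - v, b' - v)
      ⟨⟨Finset.mem_image_of_mem _ (Finset.mem_erase.mpr ⟨hav', ha'⟩), by simpa using hfa'⟩,
        ⟨Finset.mem_image_of_mem _ (Finset.mem_erase.mpr ⟨hbv', hb'⟩), by simpa using hfb'⟩, by
          simp only [Finset.mem_image, Finset.mem_erase, forall_exists_index, and_imp]
          rintro _ x hxv hx rfl
          have := hempty x hx
          rw [hside] at this
          exact not_lt.mp this⟩
    simp only [Prod.mk.injEq, sub_left_inj] at heq
    obtain ⟨rfl, rfl⟩ := heq
    exact OrientedSimplex.ext hverts hside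

/-- Every point that is not extreme for `f` is the middle vertex of exactly two `0`-facets. -/
theorem ncard_middle_facets {T : Finset (EuclideanSpace ℝ (Fin 3))} (hconv : InConvexPosition T)
    (hgen : InGeneralPosition T) {f : Module.Dual ℝ (EuclideanSpace ℝ (Fin 3))}
    (hf : Set.InjOn f T) {v : EuclideanSpace ℝ (Fin 3)} (hv : v ∈ T)
    (hlow : ∃ a ∈ T, f a < f v) (hup : ∃ b ∈ T, f v < f b) :
    {σ | σ ∈ facets T 0 ∧ IsMiddle f σ v}.ncard = 2 := by
  obtain ⟨g, hg⟩ := hconv.exists_dual hv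
  obtain ⟨h, hker, hk⟩ : ∃ h : Module.Dual ℝ (EuclideanSpace ℝ (Fin 3)),
      (∀ x, f x = 0 → g x = 0 → h x = 0 → x = 0) ∧ ∃ k, f k = 0 ∧ g k = 0 ∧ h k ≠ 0 := by
    obtain ⟨a, ha, hfa⟩ := hlow
    obtain ⟨b, hb, hfb⟩ := hup
    refine exists_complementary_functional (by simp) f g (a := a - v) (b := b - v) (ne_of_lt ?_)
    have hga := hg a ha (fun e ↦ lt_irrefl (f v) (e ▸ hfa))
    have hgb := hg b hb (fun e ↦ lt_irrefl (f v) (e ▸ hfb))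
    simp only [map_sub]
    nlinarith [mul_pos (sub_pos.mpr hfa) (sub_pos.mpr hgb),
      mul_pos (sub_pos.mpr hga) (sub_pos.mpr hfb)]
  obtain ⟨σ, a, b, hσ, hfa, hfb, hverts, hside, huniq⟩ :=
    exists_middle_facet hgen hf hv hg hlow hup hker hk
  obtain ⟨σ', a', b', hσ', hfa', hfb', hverts', hside', huniq'⟩ :=
    exists_middle_facet (h := -h) hgen hf hv hg hlow hup
      (fun x h1 h2 h3 ↦ hker x h1 h2 (by simpa using h3)) (by simpa using hk)
  -- The functionals `h` and `-h` yield the two crossings. If the facets coincided, a point of the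
  -- positive side would have a determinant of both signs.
  refine Set.ncard_eq_two.mpr ⟨σ, σ', ?_, ?_⟩
  · rintro rfl
    obtain ⟨rfl, rfl⟩ := eq_of_insert_eq hfa hfb hfa' hfb' (hverts.symm.trans hverts')
    obtain ⟨u, hu⟩ := σ.posSide_nonempty
    have hu' := hu
    rw [hside, Set.mem_ofPred_eq] at hu
    rw [hside', Set.mem_ofPred_eq, detOf_neg] at hu'
    linarith
  · ext τ
    simp only [Set.mem_ofPred_eq, Set.mem_insert_iff, Set.mem_singleton_iff]
    constructor
    · rintro ⟨hτ, hmid⟩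
      obtain ⟨c, e, hfc, hfe, hτverts⟩ := hmid.exists_verts_eq
      have hsub := (mem_facets_zero.mp hτ).1
      obtain ⟨F, α, hF, hFv, hFside⟩ := τ.isHalfSpace
      have hFvv : F v = α := hFv v (by simp [hτverts])
      have hFc : F c = α := hFv c (by simp [hτverts])
      have hFe : F e = α := hFv e (by simp [hτverts])
      -- The functional defining the side of `τ` is a multiple of the determinant; the sign of the
      -- factor decides which of the two facets `τ` is.
      obtain ⟨r, hr, hFr⟩ := exists_eq_smul_detOf hker (a := c - v) (b := e - v)
        (fun s t hst ↦ hgen.coeffs_eq_zero_of_three (x := c) (y := e) hv (hsub (by simp [hτverts]))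
          (hsub (by simp [hτverts])) (fun e ↦ lt_irrefl (f v) (e ▸ hfc))
          (fun e ↦ lt_irrefl (f v) (e ▸ hfe)) (fun hce ↦ lt_asymm hfc (hce ▸ hfe)) hst) hF
        (by simp [hFc, hFvv]) (by simp [hFe, hFvv])
      have hFx : ∀ x, α < F x ↔ 0 < r * detOf f g h (c - v) (e - v) (x - v) := by
        intro x
        rw [← hFr, map_sub, hFvv, sub_pos]
      rcases lt_or_gt_of_ne hr with hr | hr
      · left
        refine huniq τ c e hτ hfc hfe hτverts ?_
        rw [hFside]
        ext x
        rw [Set.mem_ofPred_eq, Set.mem_ofPred_eq, hFx]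
        exact ⟨fun hx ↦ neg_of_mul_pos_right hx hr.le, mul_pos_of_neg_of_neg hr⟩
      · right
        refine huniq' τ c e hτ hfc hfe hτverts ?_
        rw [hFside]
        ext x
        rw [Set.mem_ofPred_eq, Set.mem_ofPred_eq, hFx, mul_pos_iff_of_pos_left hr, detOf_neg,
          neg_lt_zero]
    · rintro (rfl | rfl)
      · exact ⟨hσ, by simp [hverts], ⟨a, by simp [hverts], hfa⟩, b, by simp [hverts], hfb⟩
      · exact ⟨hσ', by simp [hverts'], ⟨a', by simp [hverts'], hfa'⟩, b', by simp [hverts'], hfb'⟩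

end Middle

/-! ### Counting the facets by their middle vertices -/

section FacetCount

/-- Only the minimum and the maximum are lost; truncated subtraction covers sets with at most one
element. For the vertices of a triangle the count is `1`, which is why the middle vertex exists and
is unique. -/
theorem card_filter_between {V : Type*} (T : Finset V) (f : V → ℝ)
    (hf : Set.InjOn f T) [DecidablePred fun v ↦ (∃ a ∈ T, f a < f v) ∧ ∃ b ∈ T, f v < f b] :
    (T.filter fun v ↦ (∃ a ∈ T, f a < f v) ∧ ∃ b ∈ T, f v < f b).card = T.card - 2 := by
  classical
  rcases T.eq_empty_or_nonempty with rfl | hne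
  · simp
  obtain ⟨p, hp, hmin⟩ := T.exists_min_image f hne
  obtain ⟨q, hq, hmax⟩ := T.exists_max_image f hne
  have hset : (T.filter fun v ↦ (∃ a ∈ T, f a < f v) ∧ ∃ b ∈ T, f v < f b)
      = (T.erase p).erase q := by
    ext v
    simp only [Finset.mem_filter, Finset.mem_erase]
    constructor
    · rintro ⟨hv, ⟨a, ha, hav⟩, b, hb, hvb⟩
      refine ⟨?_, ?_, hv⟩
      · rintro rfl
        exact absurd hvb (not_lt.mpr (hmax b hb))
      · rintro rfl
        exact absurd hav (not_lt.mpr (hmin a ha))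
    · rintro ⟨hvq, hvp, hv⟩
      exact ⟨hv, ⟨p, hp, lt_of_le_of_ne (hmin v hv) fun h ↦ hvp (hf hp hv h).symm⟩,
        q, hq, lt_of_le_of_ne (hmax v hv) fun h ↦ hvq (hf hv hq h)⟩
  rw [hset]
  by_cases hpq : q = p
  · subst hpq
    have : T = {q} := by
      refine Finset.eq_singleton_iff_unique_mem.mpr ⟨hp, fun x hx ↦ ?_⟩
      exact hf hx hp (le_antisymm (hmax x hx) (hmin x hx))
    simp [this]
  · rw [Finset.card_erase_of_mem (Finset.mem_erase.mpr ⟨hpq, hq⟩), Finset.card_erase_of_mem hp]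
    omega

theorem OrientedSimplex.exists_isMiddle (σ : OrientedSimplex 3)
    {f : Module.Dual ℝ (EuclideanSpace ℝ (Fin 3))} (hf : Set.InjOn f σ.verts) :
    ∃ v, IsMiddle f σ v := by
  classical
  have hcard := card_filter_between σ.verts f hf
  rw [σ.card_verts] at hcard
  obtain ⟨v, hv⟩ := Finset.card_pos.mp (Nat.lt_of_lt_of_eq Nat.one_pos hcard.symm)
  exact ⟨v, by simpa [IsMiddle] using hv⟩

theorem IsMiddle.unique {f : Module.Dual ℝ (EuclideanSpace ℝ (Fin 3))} {σ : OrientedSimplex 3}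
    (hf : Set.InjOn f σ.verts) {v w : EuclideanSpace ℝ (Fin 3)} (hv : IsMiddle f σ v)
    (hw : IsMiddle f σ w) : v = w := by
  classical
  have hcard := card_filter_between σ.verts f hf
  rw [σ.card_verts] at hcard
  refine Finset.card_le_one.mp hcard.le v ?_ w ?_
  · simpa [IsMiddle] using hv
  · simpa [IsMiddle] using hw

/-- The number of facets of a simplicial 3-polytope. -/
theorem ncard_facets_zero {T : Finset (EuclideanSpace ℝ (Fin 3))} (hconv : InConvexPosition T)
    (hgen : InGeneralPosition T) : (facets T 0).ncard = 2 * (T.card - 2) := by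
  classical
  obtain ⟨f, hf⟩ := exists_dual_injOn T
  have hcount : ∀ v ∈ T, {σ | σ ∈ facets T 0 ∧ IsMiddle f σ v}.ncard
      = if (∃ a ∈ T, f a < f v) ∧ ∃ b ∈ T, f v < f b then 2 else 0 := by
    intro v hv
    split_ifs with h
    · exact ncard_middle_facets hconv hgen hf hv h.1 h.2
    · convert Set.ncard_empty (OrientedSimplex 3)
      rw [Set.eq_empty_iff_forall_notMem]
      rintro σ ⟨hσ, -, ⟨a, ha, hav⟩, b, hb, hvb⟩
      have hsub := (mem_facets_zero.mp hσ).1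
      exact h ⟨⟨a, hsub ha, hav⟩, b, hsub hb, hvb⟩
  have hfin : ∀ v : T, {σ | σ ∈ facets T 0 ∧ IsMiddle f σ v}.Finite := by
    rintro ⟨v, hv⟩
    by_cases h : (∃ a ∈ T, f a < f v) ∧ ∃ b ∈ T, f v < f b
    -- An infinite set has `ncard` zero, so the count `2` also proves finiteness.
    · exact Set.finite_of_ncard_ne_zero (by simp [ncard_middle_facets hconv hgen hf hv h.1 h.2])
    · refine Set.Finite.subset Set.finite_empty ?_
      rintro σ ⟨hσ, -, ⟨a, ha, hav⟩, b, hb, hvb⟩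
      have hsub := (mem_facets_zero.mp hσ).1
      exact h ⟨⟨a, hsub ha, hav⟩, b, hsub hb, hvb⟩
  have hunion : facets T 0 = ((T.attach.biUnion fun v ↦ (hfin v).toFinset : Finset _) : Set _) := by
    ext σ
    simp only [Finset.coe_biUnion, Finset.mem_coe, Finset.mem_attach, Set.iUnion_true,
      Set.Finite.coe_toFinset, Set.mem_iUnion, Set.mem_ofPred_eq, exists_and_left]
    refine ⟨fun hσ ↦ ⟨hσ, ?_⟩, fun h ↦ h.1⟩
    have hsub := (mem_facets_zero.mp hσ).1
    obtain ⟨v, hv⟩ := σ.exists_isMiddle (hf.mono hsub)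
    exact ⟨⟨v, hsub hv.1⟩, hv⟩
  rw [hunion, Set.ncard_coe_finset, Finset.card_biUnion]
  · have : ∀ v ∈ T.attach, (hfin v).toFinset.card
        = if (∃ a ∈ T, f a < f v) ∧ ∃ b ∈ T, f v < f b then 2 else 0 := by
      intro v _
      rw [← Set.ncard_eq_toFinset_card _ (hfin v)]
      exact hcount v v.2
    rw [Finset.sum_congr rfl this, Finset.sum_attach T
      (fun v ↦ if (∃ a ∈ T, f a < f v) ∧ ∃ b ∈ T, f v < f b then 2 else 0),
      ← Finset.sum_filter, Finset.sum_const, card_filter_between T f hf, smul_eq_mul, mul_comm]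
  · intro v _ w _ hvw
    rw [Function.onFun, Finset.disjoint_left]
    intro σ h1 h2
    simp only [Set.Finite.mem_toFinset, Set.mem_ofPred_eq] at h1 h2
    exact hvw (Subtype.ext (h1.2.unique (hf.mono (mem_facets_zero.mp h1.1).1) h2.2))

/-- Every triangle is a `0`-facet of its own vertex set, and a triple of points has only two
`0`-facets, one for each orientation. -/
theorem finite_simplices {S : Finset (EuclideanSpace ℝ (Fin 3))} (hconv : InConvexPosition S)
    (hgen : InGeneralPosition S) : {σ : OrientedSimplex 3 | σ.verts ⊆ S}.Finite := by
  refine Set.Finite.subset (Set.Finite.biUnion (s := {D | D ∈ S.powersetCard 3})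
    (S.powersetCard 3).finite_toSet (t := fun D ↦ facets D 0) fun D hD ↦ ?_) fun σ hσ ↦ ?_
  · obtain ⟨hDS, hD3⟩ := Finset.mem_powersetCard.mp hD
    refine Set.finite_of_ncard_ne_zero ?_
    rw [ncard_facets_zero (hconv.mono hDS) (hgen.mono hDS), hD3]
    norm_num
  · exact Set.mem_biUnion (Finset.mem_powersetCard.mpr ⟨hσ, σ.card_verts⟩ : σ.verts ∈ _)
      (mem_facets_zero.mpr ⟨subset_rfl, fun x hx ↦ σ.notMem_posSide hx⟩)

end FacetCount

/-! ### Random sampling of colors -/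

section Sampling

/-- The probability that a random set contains `A` and misses `B`, if every element is
chosen independently with probability `p`. -/
theorem sum_weight {ι R : Type*} [Fintype ι] [DecidableEq ι] [CommRing R] {p q : R}
    (hpq : p + q = 1) (A B : Finset ι) :
    (∑ s : Finset ι, if A ⊆ s ∧ Disjoint B s then p ^ s.card * q ^ (Fintype.card ι - s.card) else 0)
      = if Disjoint A B then p ^ A.card * q ^ B.card else 0 := by
  -- Expanding the product over all elements produces the sum over subsets; the zero factors remove
  -- those that miss part of `A` or meet `B`.
  have hprod := Finset.prod_add (fun i ↦ if i ∉ B then p else 0) (fun i ↦ if i ∉ A then q else 0)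
    (Finset.univ : Finset ι)
  have hright : ∀ s : Finset ι, (∏ i ∈ s, if i ∉ B then p else 0)
      * (∏ i ∈ Finset.univ \ s, if i ∉ A then q else 0)
      = if A ⊆ s ∧ Disjoint B s then p ^ s.card * q ^ (Fintype.card ι - s.card) else 0 := by
    intro s
    rw [Finset.prod_ite_zero, Finset.prod_ite_zero, Finset.prod_const, Finset.prod_const,
      ← Finset.compl_eq_univ_sdiff, Finset.card_compl]
    have h1 : (∀ i ∈ s, i ∉ B) ↔ Disjoint B s := Finset.disjoint_right.symm
    have h2 : (∀ i ∈ sᶜ, i ∉ A) ↔ A ⊆ s := by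
      simp only [Finset.mem_compl, not_imp_not]
      rfl
    simp only [h1, h2]
    by_cases hA : A ⊆ s <;> by_cases hB : Disjoint B s <;> simp [hA, hB]
  rw [Finset.powerset_univ, Finset.sum_congr rfl fun s _ ↦ hright s] at hprod
  rw [← hprod]
  split_ifs with hAB
  · have hleft : ∀ i, (if i ∉ B then p else 0) + (if i ∉ A then q else 0)
        = (if i ∈ A then p else 1) * (if i ∈ B then q else 1) := by
      intro i
      have : i ∈ A → i ∉ B := fun hi ↦ Finset.disjoint_left.mp hAB hi
      by_cases hA : i ∈ A <;> by_cases hB : i ∈ B <;> simp_all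
    rw [Finset.prod_congr rfl fun i _ ↦ hleft i, Finset.prod_mul_distrib]
    simp
  · obtain ⟨i, hA, hB⟩ := Finset.not_disjoint_iff.mp hAB
    exact Finset.prod_eq_zero (Finset.mem_univ i) (by simp [hA, hB])

variable {d m : ℕ} {S : Finset (EuclideanSpace ℝ (Fin d))}

/-- The points whose color belongs to `R`. -/
noncomputable def pointsWithColor (κ : S → Fin m) (R : Finset (Fin m)) :
    Finset (EuclideanSpace ℝ (Fin d)) :=
  (S.attach.filter fun s ↦ κ s ∈ R).map (Function.Embedding.subtype _)

theorem mem_pointsWithColor {κ : S → Fin m} {R : Finset (Fin m)}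
    {x : EuclideanSpace ℝ (Fin d)} :
    x ∈ pointsWithColor κ R ↔ ∃ h : x ∈ S, κ ⟨x, h⟩ ∈ R := by
  simp [pointsWithColor]

theorem pointsWithColor_subset (κ : S → Fin m) (R : Finset (Fin m)) :
    pointsWithColor κ R ⊆ S :=
  fun _ hx ↦ (mem_pointsWithColor.mp hx).1

theorem card_le_card_pointsWithColor {κ : S → Fin m} (hκ : Function.Surjective κ)
    (R : Finset (Fin m)) : R.card ≤ (pointsWithColor κ R).card := by
  classical
  rw [pointsWithColor, Finset.card_map]
  refine (Finset.card_le_card fun i hi ↦ ?_).trans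
    (Finset.card_image_le (s := S.attach.filter fun s ↦ κ s ∈ R) (f := κ))
  obtain ⟨s, rfl⟩ := hκ i
  exact Finset.mem_image_of_mem _ (by simpa using hi)

/-- Linearity of expectation: each point survives with probability `p`, however many points share
its color. -/
theorem sum_weight_mul_card_pointsWithColor {R : Type*} [CommRing R] {p q : R}
    (hpq : p + q = 1) (κ : S → Fin m) :
    ∑ s : Finset (Fin m), p ^ s.card * q ^ (m - s.card) * ((pointsWithColor κ s).card : R)
      = S.card * p := by
  classical
  have hcard : ∀ s : Finset (Fin m), ((pointsWithColor κ s).card : R)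
      = ∑ x ∈ S.attach, if κ x ∈ s then 1 else 0 := by
    intro s
    rw [pointsWithColor, Finset.card_map, Finset.sum_boole]
  simp only [hcard, Finset.mul_sum, mul_ite, mul_one, mul_zero]
  rw [Finset.sum_comm]
  have hone : ∀ x ∈ S.attach, (∑ s : Finset (Fin m),
      if κ x ∈ s then p ^ s.card * q ^ (m - s.card) else 0) = p := by
    intro x _
    simpa using sum_weight hpq {κ x} ∅
  rw [Finset.sum_congr rfl hone]
  simp

/-- The set of colors of the points of `S` in `A`, as a finite set. -/
noncomputable def colorFinset (κ : S → Fin m) (A : Set (EuclideanSpace ℝ (Fin d))) :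
    Finset (Fin m) :=
  (Set.toFinite (colorsOf κ A)).toFinset

theorem coe_colorFinset (κ : S → Fin m) (A : Set (EuclideanSpace ℝ (Fin d))) :
    (colorFinset κ A : Set (Fin m)) = colorsOf κ A :=
  Set.Finite.coe_toFinset _

theorem card_colorFinset (κ : S → Fin m) (A : Set (EuclideanSpace ℝ (Fin d))) :
    (colorFinset κ A).card = (colorsOf κ A).ncard := by
  rw [← coe_colorFinset, Set.ncard_coe_finset]

theorem disjoint_colorFinset (κ : S → Fin m) (A B : Set (EuclideanSpace ℝ (Fin d))) :
    Disjoint (colorFinset κ A) (colorFinset κ B) ↔ Disjoint (colorsOf κ A) (colorsOf κ B) := by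
  rw [← coe_colorFinset, ← coe_colorFinset, Finset.disjoint_coe]

theorem mem_colorFinset {κ : S → Fin m} {A : Set (EuclideanSpace ℝ (Fin d))} {i : Fin m} :
    i ∈ colorFinset κ A ↔ ∃ s : S, (s : EuclideanSpace ℝ (Fin d)) ∈ A ∧ κ s = i :=
  Set.Finite.mem_toFinset _

theorem mem_facets_pointsWithColor {κ : S → Fin m} {R : Finset (Fin m)} {σ : OrientedSimplex d}
    (hσ : σ.verts ⊆ S) :
    σ ∈ facets (pointsWithColor κ R) 0 ↔ colorFinset κ (σ.verts : Set _) ⊆ R ∧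
      Disjoint (colorFinset κ σ.posSide) R := by
  rw [mem_facets_zero, Finset.disjoint_left]
  refine and_congr ⟨?_, ?_⟩ ⟨?_, ?_⟩
  · intro h i hi
    obtain ⟨s, hs, rfl⟩ := mem_colorFinset.mp hi
    exact (mem_pointsWithColor.mp (h hs)).2
  · intro h x hx
    exact mem_pointsWithColor.mpr ⟨hσ hx, h (mem_colorFinset.mpr ⟨⟨x, hσ hx⟩, hx, rfl⟩)⟩
  · intro h i hi hiR
    obtain ⟨s, hs, rfl⟩ := mem_colorFinset.mp hi
    exact h s (mem_pointsWithColor.mpr ⟨s.2, hiR⟩) hs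
  · intro h x hx hxσ
    obtain ⟨hxS, hxR⟩ := mem_pointsWithColor.mp hx
    exact h (mem_colorFinset.mpr ⟨⟨x, hxS⟩, hxσ, rfl⟩) hxR

theorem card_colorFinset_verts_le {κ : S → Fin m} (σ : OrientedSimplex d) :
    (colorFinset κ (σ.verts : Set _)).card ≤ d := by
  classical
  have hsub : colorFinset κ (σ.verts : Set _)
      ⊆ (S.attach.filter fun s : S ↦ (s : EuclideanSpace ℝ (Fin d)) ∈ σ.verts).image κ := by
    intro i hi
    obtain ⟨s, hs, rfl⟩ := mem_colorFinset.mp hi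
    exact Finset.mem_image_of_mem _ (by simpa using hs)
  refine (Finset.card_le_card hsub).trans (Finset.card_image_le.trans ?_)
  rw [← Finset.card_map (Function.Embedding.subtype _)]
  refine (Finset.card_le_card fun x hx ↦ ?_).trans σ.card_verts.le
  simp only [Finset.mem_map, Finset.mem_filter] at hx
  obtain ⟨s, ⟨-, hs⟩, rfl⟩ := hx
  exact hs

end Sampling

/-! ### The expected number of facets as a power series -/

section PowerSeriesIdentity

open PowerSeries

variable {m : ℕ} {S : Finset (EuclideanSpace ℝ (Fin 3))}

/-- Sampling each color with probability `1 - X`, the expected number of facets of the convex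
hull of the sampled points is `2 (n (1 - X) - 2)`, up to the events that fewer than two colors
are sampled. -/
theorem X_pow_dvd_sum_simplices (hconv : InConvexPosition S) (hgen : InGeneralPosition S)
    {κ : S → Fin m} (hκ : Function.Surjective κ) :
    (X : ℤ⟦X⟧) ^ (m - 1) ∣
      (∑ σ ∈ (finite_simplices hconv hgen).toFinset,
        if Disjoint (colorFinset κ (σ.verts : Set _)) (colorFinset κ σ.posSide) then
          (1 - X : ℤ⟦X⟧) ^ (colorFinset κ (σ.verts : Set _)).card
            * X ^ (colorFinset κ σ.posSide).card
        else 0) - (2 * (S.card : ℤ⟦X⟧) * (1 - X) - 4) := by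
  classical
  have hpq : (1 - X : ℤ⟦X⟧) + X = 1 := by ring
  have hsum : ∀ σ ∈ (finite_simplices hconv hgen).toFinset,
      (if Disjoint (colorFinset κ (σ.verts : Set _)) (colorFinset κ σ.posSide) then
        (1 - X : ℤ⟦X⟧) ^ (colorFinset κ (σ.verts : Set _)).card
          * X ^ (colorFinset κ σ.posSide).card else 0)
      = ∑ R : Finset (Fin m), if σ ∈ facets (pointsWithColor κ R) 0 then
          (1 - X : ℤ⟦X⟧) ^ R.card * X ^ (m - R.card) else 0 := by
    intro σ hσ
    rw [← sum_weight hpq, Fintype.card_fin]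
    refine Finset.sum_congr rfl fun R _ ↦ if_congr ?_ rfl rfl
    rw [mem_facets_pointsWithColor ((Set.Finite.mem_toFinset _).mp hσ)]
  have hcount : ∀ R : Finset (Fin m), (∑ σ ∈ (finite_simplices hconv hgen).toFinset,
      if σ ∈ facets (pointsWithColor κ R) 0 then
          (1 - X : ℤ⟦X⟧) ^ R.card * X ^ (m - R.card) else 0)
      = (1 - X : ℤ⟦X⟧) ^ R.card * X ^ (m - R.card)
        * ((2 * ((pointsWithColor κ R).card - 2) : ℕ) : ℤ⟦X⟧) := by
    intro R
    have hR := pointsWithColor_subset κ R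
    rw [← Finset.sum_filter, Finset.sum_const, ← ncard_facets_zero (hconv.mono hR) (hgen.mono hR),
      nsmul_eq_mul, mul_comm]
    congr 2
    rw [← Set.ncard_coe_finset]
    congr 1
    ext σ
    simp only [Finset.coe_filter, Set.Finite.mem_toFinset, Set.mem_ofPred_eq, and_iff_right_iff_imp]
    exact fun h ↦ (mem_facets_zero.mp h).1.trans hR
  have hmain : (2 * (S.card : ℤ⟦X⟧) * (1 - X) - 4 : ℤ⟦X⟧)
      = ∑ R : Finset (Fin m), (1 - X : ℤ⟦X⟧) ^ R.card * X ^ (m - R.card)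
          * (2 * ((pointsWithColor κ R).card : ℤ⟦X⟧) - 4) := by
    have h1 := sum_weight_mul_card_pointsWithColor hpq κ
    have h2 := sum_weight hpq (∅ : Finset (Fin m)) ∅
    simp only [Finset.empty_subset, Finset.disjoint_empty_left, and_self, if_true,
      Fintype.card_fin, Finset.card_empty, pow_zero, mul_one] at h2
    calc (2 * (S.card : ℤ⟦X⟧) * (1 - X) - 4 : ℤ⟦X⟧) 
        = 2 * ((S.card : ℤ⟦X⟧) * (1 - X)) - 4 * 1 := by ring
      _ = 2 * _ - 4 * _ := congrArg₂ (fun x y ↦ 2 * x - 4 * y) h1.symm h2.symm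
      _ = _ := by
        rw [Finset.mul_sum, Finset.mul_sum, ← Finset.sum_sub_distrib]
        exact Finset.sum_congr rfl fun R _ ↦ by ring
  rw [Finset.sum_congr rfl hsum, Finset.sum_comm, Finset.sum_congr rfl fun R _ ↦ hcount R, hmain,
    ← Finset.sum_sub_distrib]
  refine Finset.dvd_sum fun R _ ↦ ?_
  rw [← mul_sub]
  -- Two sampled colors give at least two points, so the truncated subtraction is exact and the term
  -- vanishes. Otherwise the weight contains `X ^ (m - R.card)`, a multiple of `X ^ (m - 1)`.
  rcases le_or_gt 2 R.card with hR | hR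
  · have hle := hR.trans (card_le_card_pointsWithColor hκ R)
    rw [Nat.cast_mul, Nat.cast_sub hle]
    convert dvd_zero _
    push_cast
    ring
  · exact Dvd.dvd.mul_right (Dvd.dvd.mul_left (pow_dvd_pow _ (by omega)) _) _

theorem coeff_mk_one_sq (k : ℕ) : coeff k ((mk 1 : ℤ⟦X⟧) ^ 2) = (k : ℤ) + 1 := by
  rw [mk_one_pow_eq_mk_choose_add ℤ 1, coeff_mk, Nat.choose_one_right]
  push_cast
  ring

theorem two_mul_coeff_mk_one_cube (k : ℕ) :
    2 * coeff k ((mk 1 : ℤ⟦X⟧) ^ 3) = ((k : ℤ) + 1) * (k + 2) := by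
  rw [mk_one_pow_eq_mk_choose_add ℤ 2, coeff_mk]
  have h2 : (2 + k).choose 2 * 2 = (k + 1) * (k + 2) := by
    rw [add_comm 2 k, Nat.choose_two_right, Nat.div_mul_cancel (Nat.even_mul_pred_self _).two_dvd]
    simp [mul_comm]
  rw [mul_comm]
  exact_mod_cast h2

end PowerSeriesIdentity

/-! ### Comparison of coefficients and the uncolored case -/

section Main

open PowerSeries

variable {m : ℕ} {S : Finset (EuclideanSpace ℝ (Fin 3))}

theorem e_eq_sum (hconv : InConvexPosition S) (hgen : InGeneralPosition S) (κ : S → Fin m)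
    (c i : ℕ) :
    (e κ c i : ℤ) = ∑ σ ∈ (finite_simplices hconv hgen).toFinset,
      if Disjoint (colorFinset κ (σ.verts : Set _)) (colorFinset κ σ.posSide) then
        if (colorFinset κ σ.posSide).card = i ∧ (colorFinset κ (σ.verts : Set _)).card = c
          then 1 else 0
      else 0 := by
  classical
  simp only [← ite_and]
  rw [Finset.sum_boole, e, ← Set.ncard_coe_finset]
  congr 2
  ext σ
  simp only [chromaticFacets, Finset.coe_filter, Set.Finite.mem_toFinset, Set.mem_ofPred_eq,
    card_colorFinset, disjoint_colorFinset]
  rw [disjoint_comm]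

theorem card_colorFinset_verts_pos {κ : S → Fin m} {σ : OrientedSimplex 3} (hσ : σ.verts ⊆ S) :
    0 < (colorFinset κ (σ.verts : Set _)).card := by
  obtain ⟨x, hx⟩ := Finset.card_pos.mp (Nat.lt_of_lt_of_eq (Nat.succ_pos 2) σ.card_verts.symm)
  exact Finset.card_pos.mpr ⟨_, mem_colorFinset.mpr ⟨⟨x, hσ hx⟩, hx, rfl⟩⟩

/-- The contribution of one simplex to the colored facet count. -/
theorem coeff_contribution {c b : ℕ} (hc : 0 < c) (hc' : c ≤ 3) (j : ℕ) :
    coeff j ((1 - X : ℤ⟦X⟧) ^ c * X ^ b * (mk 1) ^ 3)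
      = (if b = j ∧ c = 3 then 1 else 0)
        + ∑ i ∈ Finset.range (j + 1), (if b = i ∧ c = 2 then 1 else 0)
        + ∑ i ∈ Finset.range (j + 1), ((j : ℤ) - i + 1) * (if b = i ∧ c = 1 then 1 else 0) := by
  have hinv : ((1 - X : ℤ⟦X⟧) * mk 1) = 1 := by rw [mul_comm, mk_one_mul_one_sub_eq_one]
  have hpow : (1 - X : ℤ⟦X⟧) ^ c * X ^ b * (mk 1) ^ 3 = mk 1 ^ (3 - c) * X ^ b := by
    calc (1 - X : ℤ⟦X⟧) ^ c * X ^ b * (mk 1) ^ 3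
        = (1 - X : ℤ⟦X⟧) ^ c * X ^ b * (mk 1 ^ c * mk 1 ^ (3 - c)) := by
          rw [← pow_add, Nat.add_sub_cancel' hc']
      _ = ((1 - X) * mk 1) ^ c * (mk 1 ^ (3 - c) * X ^ b) := by
          rw [mul_pow]
          ring
      _ = _ := by rw [hinv, one_pow, one_mul]
  rw [hpow, coeff_mul_X_pow']
  -- The power `(1 - X)⁻¹ ^ (3 - c)` has coefficients `k + 1` for `c = 1` and `1` for `c = 2`, and
  -- is `1` for `c = 3`.
  rcases (by omega : c = 1 ∨ c = 2 ∨ c = 3) with rfl | rfl | rfl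
  · simp only [Nat.reduceSub, coeff_mk_one_sq, OfNat.one_ne_ofNat, and_false, if_false, and_true,
      Finset.sum_const_zero, zero_add, mul_ite, mul_one, mul_zero, Finset.sum_ite_eq,
      Finset.mem_range, Nat.lt_succ_iff]
    split_ifs with h
    · rw [Nat.cast_sub h]
    · rfl
  · simp
  · simp only [Nat.sub_self, pow_zero, coeff_one]
    simp
    split_ifs <;> first | rfl | omega

/-- The linear relation between the numbers of colored facets of each chromaticity. -/
theorem colored_facet_relation (hconv : InConvexPosition S) (hgen : InGeneralPosition S)
    {κ : S → Fin m} (hκ : Function.Surjective κ) {j : ℕ} (hj : j + 2 ≤ m) :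
    (e κ 3 j : ℤ) + ∑ i ∈ Finset.range (j + 1), (e κ 2 i : ℤ)
        + ∑ i ∈ Finset.range (j + 1), ((j : ℤ) - i + 1) * (e κ 1 i : ℤ)
      = 2 * ((j : ℤ) + 1) * ((S.card : ℤ) - j - 2) := by
  classical
  -- The series `mk 1` is `(1 - X)⁻¹`, and `j < m - 1` puts the coefficient below the error term.
  have hcoeff := X_pow_dvd_iff.mp
    ((X_pow_dvd_sum_simplices hconv hgen hκ).mul_right ((mk 1) ^ 3)) j (by omega)
  have hinv : ((1 - X : ℤ⟦X⟧) * mk 1) = 1 := by rw [mul_comm, mk_one_mul_one_sub_eq_one]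
  have hmain : (2 * (S.card : ℤ⟦X⟧) * (1 - X) - 4) * (mk 1) ^ 3
      = C (2 * S.card : ℤ) * (mk 1) ^ 2 - C (4 : ℤ) * (mk 1) ^ 3 := by
    calc (2 * (S.card : ℤ⟦X⟧) * (1 - X) - 4) * (mk 1) ^ 3
        = 2 * (S.card : ℤ⟦X⟧) * ((1 - X) * mk 1) * (mk 1) ^ 2 - 4 * (mk 1) ^ 3 := by ring
      _ = _ := by
        rw [hinv, mul_one]
        simp
  rw [sub_mul, hmain, map_sub, map_sub, coeff_C_mul, coeff_C_mul, coeff_mk_one_sq,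
    Finset.sum_mul, map_sum, sub_eq_zero] at hcoeff
  have hcube := two_mul_coeff_mk_one_cube j
  have hright : 2 * ((j : ℤ) + 1) * ((S.card : ℤ) - j - 2)
      = 2 * (S.card : ℤ) * ((j : ℤ) + 1) - 4 * coeff j ((mk 1 : ℤ⟦X⟧) ^ 3) := by
    linear_combination 2 * hcube
  rw [hright, ← hcoeff]
  simp only [e_eq_sum hconv hgen]
  rw [Finset.sum_comm]
  simp only [Finset.mul_sum]
  rw [Finset.sum_comm (s := Finset.range (j + 1)), ← Finset.sum_add_distrib,
    ← Finset.sum_add_distrib]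
  refine Finset.sum_congr rfl fun σ hσ ↦ ?_
  by_cases hd : Disjoint (colorFinset κ (σ.verts : Set _)) (colorFinset κ σ.posSide)
  · simp only [if_pos hd]
    rw [coeff_contribution
      (card_colorFinset_verts_pos ((Set.Finite.mem_toFinset _).mp hσ))
      (card_colorFinset_verts_le σ)]
  · simp [if_neg hd]

theorem ncard_colorsOf {κ : S → Fin m} (hκ : Function.Injective κ)
    (A : Set (EuclideanSpace ℝ (Fin 3))) :
    (colorsOf κ A).ncard = {s | s ∈ S ∧ s ∈ A}.ncard := by
  have h1 : colorsOf κ A = κ '' {s : S | (s : EuclideanSpace ℝ (Fin 3)) ∈ A} := rfl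
  have h2 : {s | s ∈ S ∧ s ∈ A} = Subtype.val '' {s : S | (s : EuclideanSpace ℝ (Fin 3)) ∈ A} := by
    ext x
    simp [and_comm]
  rw [h1, h2, Set.ncard_image_of_injective _ hκ,
    Set.ncard_image_of_injective _ Subtype.val_injective]

theorem disjoint_colorsOf {κ : S → Fin m} (hκ : Function.Injective κ) (σ : OrientedSimplex 3) :
    Disjoint (colorsOf κ σ.posSide)
      (colorsOf κ (σ.verts : Set (EuclideanSpace ℝ (Fin 3)))) := by
  rw [Set.disjoint_left]
  rintro _ ⟨s, hs, rfl⟩ ⟨t, ht, hst⟩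
  rw [hκ hst] at ht
  exact σ.notMem_posSide ht hs

theorem ncard_colorsOf_verts {κ : S → Fin m} (hκ : Function.Injective κ) {σ : OrientedSimplex 3}
    (hσ : σ.verts ⊆ S) : (colorsOf κ (σ.verts : Set (EuclideanSpace ℝ (Fin 3)))).ncard = 3 := by
  rw [ncard_colorsOf hκ]
  refine Eq.trans ?_ σ.card_verts
  rw [← Set.ncard_coe_finset]
  congr 1
  ext x
  simpa using fun hx ↦ hσ hx

theorem chromaticFacets_three_eq_facets {κ : S → Fin m} (hκ : Function.Injective κ) (j : ℕ) :
    chromaticFacets κ 3 j = facets S j := by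
  ext σ
  simp only [chromaticFacets, facets, Set.mem_ofPred_eq]
  refine and_congr_right fun hσ ↦ ?_
  simp [disjoint_colorsOf hκ, ncard_colorsOf_verts hκ hσ, ncard_colorsOf hκ σ.posSide]

theorem e_eq_zero_of_injective {κ : S → Fin m} (hκ : Function.Injective κ) {c : ℕ} (hc : c ≠ 3)
    (j : ℕ) : e κ c j = 0 := by
  have : chromaticFacets κ c j = ∅ := by
    rw [Set.eq_empty_iff_forall_notMem]
    rintro σ ⟨hσ, -, -, h⟩
    exact hc (h.symm.trans (ncard_colorsOf_verts hκ hσ))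
  rw [e, this, Set.ncard_empty]

end Main

end ColoredFacets

theorem mainTheorem8 (n m : ℕ) (S : Finset (EuclideanSpace ℝ (Fin 3))) (hn : S.card = n)
    (hconv : ColoredFacets.InConvexPosition S) (hgen : ColoredFacets.InGeneralPosition S)
    (κ : S → Fin m) (hκ : Function.Surjective κ) (j : ℕ) (hj : j + 2 ≤ m) :
    ((ColoredFacets.e κ 3 j : ℤ)
        + ∑ i ∈ Finset.range (j + 1), (ColoredFacets.e κ 2 i : ℤ)
        + ∑ i ∈ Finset.range (j + 1), ((j : ℤ) - i + 1) * (ColoredFacets.e κ 1 i : ℤ)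
      = 2 * ((j : ℤ) + 1) * ((n : ℤ) - j - 2)) ∧
    (m = n →
      ∑ c ∈ Finset.Icc 1 3, (ColoredFacets.e κ c j : ℤ)
          = 2 * ((j : ℤ) + 1) * ((n : ℤ) - j - 2) ∧
      ((ColoredFacets.facets S j).ncard : ℤ) = 2 * ((j : ℤ) + 1) * ((n : ℤ) - j - 2)) := by
  subst hn
  have hrel := ColoredFacets.colored_facet_relation hconv hgen hκ hj
  refine ⟨hrel, fun hm ↦ ?_⟩
  -- A surjection between sets of equal size is injective, so all triangles have three vertex colors
  -- and counting colors is counting points.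
  have hinj : Function.Injective κ :=
    ((Fintype.bijective_iff_surjective_and_card κ).mpr ⟨hκ, by simp [hm]⟩).injective
  have h1 := ColoredFacets.e_eq_zero_of_injective hinj (c := 1) (by norm_num)
  have h2 := ColoredFacets.e_eq_zero_of_injective hinj (c := 2) (by norm_num)
  simp only [h1, h2, Nat.cast_zero, mul_zero, Finset.sum_const_zero, add_zero] at hrel
  refine ⟨?_, ?_⟩
  · rw [show Finset.Icc 1 3 = {1, 2, 3} from rfl]
    simp [h1, h2, hrel]
  · rw [← hrel, ColoredFacets.e, ColoredFacets.chromaticFacets_three_eq_facets hinj]
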